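/- Let $G$ be a finite simple undirected graph that is bridgeless (no edge of $G$ is a bridge) and has diameter $\operatorname{diam}(G)=3$. Then its rainbow connection number satisfies $rc(G)\le 9$. Here $rc(G)$ is the minimum integer $k$ for which the edges of $G$ can be colored with $k$ colors (adjacent edges may receive the same color) so that every two distinct vertices of $G$ are connected by a rainbow path, that is, a path no two of whose edges have the same color. -/

import Mathlib

namespace SimpleGraph

variable {V : Type*}

/-- No edge of `G` is a bridge. -/
def Bridgeless (G : SimpleGraph V) : Prop :=
  ∀ e ∈ G.edgeSet, ¬ G.IsBridge e

/-- Under the edge-coloring `c` (adjacent edges may share a color), `p` is a rainbow path: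
`p` is a path and no two distinct edges of `p` have the same color. -/
def IsRainbowPath {G : SimpleGraph V} {K : Type*} (c : G.EdgeLabeling K) {u v : V}
    (p : G.Walk u v) : Prop :=
  p.IsPath ∧
    ∀ e f : G.edgeSet, (e : Sym2 V) ∈ p.edges → (f : Sym2 V) ∈ p.edges → c e = c f → e = f

/-- `c` is a rainbow edge-coloring: every pair of distinct vertices is connected by a
rainbow path. -/
def IsRainbowColoring {G : SimpleGraph V} {K : Type*} (c : G.EdgeLabeling K) : Prop :=
  ∀ u v : V, u ≠ v → ∃ p : G.Walk u v, IsRainbowPath c p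

/-- The rainbow connection number: the least `k` for which `G` has a rainbow edge-coloring
with colors from a set of `k` colors (`⊤` if there is no such `k`). -/
noncomputable def rainbowConnectionNumber (G : SimpleGraph V) : ℕ∞ :=
  ⨅ (k : ℕ) (_ : ∃ c : G.EdgeLabeling (Fin k), IsRainbowColoring c), (k : ℕ∞)

end SimpleGraph

/-! The proof splits on whether every edge lies in a triangle. Both cases rest on marking. Among
vertices with too few useful edges towards a root, take a minimal dominating set
(`exists_minimal_dominating`) and give one edge of each chosen vertex a second colour. An unchosen
vertex can step to a chosen neighbour (or to one that needs no help), and minimality lets a chosen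
vertex step to an unchosen one or use another edge. So both kinds gain a further route.

If every edge lies in a triangle, a breadth-first search from any root has at most three levels
below it. Each level spends three colours of its own: unmarked edges up, marked edges up, edges
inside the level.

Otherwise some edge `xy` lies in no triangle, and the distances to `x` and `y` place each vertex in
one of eight cells. The colour of an edge depends only on the cells of its ends (one cell being cut
in two) and on the marks. So there are finitely many kinds of vertex, each with a list of colour
sets of routes to `x` or `y` (`routeProfiles`). A finite check finds colour-disjoint routes for any
two kinds, joined if necessary through `xy`, which has colour 0. In this case bridgelessness enters
as minimum degree at least two. Diameter 3 enters a second time in `reachNear_dominates` and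
`crossDominates_or`, which let far vertices cross to the other root; the latter also decides which
end of the edge plays `x`. -/

namespace SimpleGraph

/-! ### Rainbow walks -/

/-- Some walk from `u` to `v` has pairwise distinct edge colours, all of them in `s`. -/
def RainbowLink {V K : Type*} (G : SimpleGraph V) (f : Sym2 V → K) (u v : V) (s : Finset K) :
    Prop :=
  ∃ p : G.Walk u v, (p.edges.map f).Nodup ∧ ∀ e ∈ p.edges, f e ∈ s

namespace RainbowLink

variable {V K : Type*} {G : SimpleGraph V} {f : Sym2 V → K} {u v w : V}
  {s t r : Finset K}

theorem refl (u : V) (s : Finset K) : G.RainbowLink f u u s := ⟨.nil, by simp, by simp⟩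

theorem mono (h : G.RainbowLink f u v s) (hst : s ⊆ t) : G.RainbowLink f u v t := by
  obtain ⟨p, hp, hs⟩ := h
  exact ⟨p, hp, fun e he => hst (hs e he)⟩

theorem symm (h : G.RainbowLink f u v s) : G.RainbowLink f v u s := by
  obtain ⟨p, hp, hs⟩ := h
  refine ⟨p.reverse, ?_, fun e he => hs e (by simpa using he)⟩
  rwa [Walk.edges_reverse, List.map_reverse, List.nodup_reverse]

theorem trans [DecidableEq K] (h : G.RainbowLink f u v s) (h' : G.RainbowLink f v w t) (hst : Disjoint s t) :
    G.RainbowLink f u w (s ∪ t) := by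
  obtain ⟨p, hp, hs⟩ := h
  obtain ⟨q, hq, ht⟩ := h'
  refine ⟨p.append q, ?_, fun e he => ?_⟩
  · rw [Walk.edges_append, List.map_append, List.nodup_append']
    refine ⟨hp, hq, fun c hc hc' => ?_⟩
    obtain ⟨e, he, rfl⟩ := List.mem_map.1 hc
    obtain ⟨e', he', hee⟩ := List.mem_map.1 hc'
    exact Finset.disjoint_left.1 hst (hs e he) (hee ▸ ht e' he')
  · rw [Walk.edges_append, List.mem_append] at he
    exact Finset.mem_union.2 (he.imp (hs e) (ht e))

theorem single {i : K} (huv : G.Adj u v) (hi : f s(u, v) = i) : G.RainbowLink f u v {i} :=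
  ⟨.cons huv .nil, by simp, by simp [hi]⟩

/-- Prepend an edge of colour `i` to a rainbow walk with colours in `s`. -/
theorem cons [DecidableEq K] {i : K} (huv : G.Adj u v) (hi : f s(u, v) = i) (h : G.RainbowLink f v w s)
    (his : i ∉ s) (ht : insert i s ⊆ t) : G.RainbowLink f u w t :=
  ((single huv hi).trans h (by simpa using his)).mono (by rwa [← Finset.insert_eq])

end RainbowLink

/-- Cutting the loops out of a walk leaves a sublist of its edges, so distinct colours stay
distinct. Hence walks may be concatenated freely without checking that they are paths. -/
theorem isRainbowColoring_of_forall_rainbowLink {V K : Type*} {G : SimpleGraph V}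
    {f : Sym2 V → K} (h : ∀ u v, ∃ s, G.RainbowLink f u v s) :
    IsRainbowColoring (fun e : G.edgeSet => f e) := by
  classical
  intro u v _
  obtain ⟨s, p, hp, -⟩ := h u v
  refine ⟨p.bypass, p.bypass_isPath, fun e e' he he' hc => Subtype.ext ?_⟩
  exact List.inj_on_of_nodup_map (hp.sublist ((p.edges_bypass_sublist_edges).map f)) he he' hc

theorem rainbowConnectionNumber_le_of_rainbowLink {V : Type*} {G : SimpleGraph V} {n : ℕ}
    {f : Sym2 V → Fin n} (h : ∀ u v, ∃ s, G.RainbowLink f u v s) :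
    G.rainbowConnectionNumber ≤ n :=
  iInf₂_le n ⟨_, isRainbowColoring_of_forall_rainbowLink h⟩

/-! ### Minimal dominating sets, degrees and distances -/

/-- If `P ∪ S` dominates `W`, then there is a minimal `F ⊆ S` such that `P ∪ F` dominates `W`;
every vertex of `F` has a private neighbour in `W`, possibly itself. -/
theorem exists_minimal_dominating {V : Type*} [Finite V] (R : V → V → Prop)
    (hR : ∀ v, ¬ R v v) (W S P : Set V)
    (h : ∀ w ∈ W, w ∈ S ∨ ∃ v, R w v ∧ (v ∈ P ∨ v ∈ S)) :
    ∃ F ⊆ S, (∀ w ∈ W, w ∈ F ∨ ∃ v, R w v ∧ (v ∈ P ∨ v ∈ F)) ∧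
      ∀ f ∈ F, (f ∈ W ∧ ∀ v, R f v → v ∉ P ∧ v ∉ F) ∨ ∃ r ∈ W, r ∉ F ∧ R r f := by
  obtain ⟨F, ⟨hFS, hF⟩, hmin⟩ := exists_minimal_of_wellFoundedLT
    (fun F : Set V => F ⊆ S ∧ ∀ w ∈ W, w ∈ F ∨ ∃ v, R w v ∧ (v ∈ P ∨ v ∈ F)) ⟨S, le_rfl, h⟩
  refine ⟨F, hFS, hF, fun f hf => ?_⟩
  by_contra! hcon
  obtain ⟨h1, h2⟩ := hcon
  have hdom : ∀ w ∈ W, w ∈ F \ {f} ∨ ∃ v, R w v ∧ (v ∈ P ∨ v ∈ F \ {f}) := by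
    intro w hw
    by_cases hwf : w = f
    · subst hwf
      obtain ⟨v, hv, hv'⟩ := h1 hw
      refine Or.inr ⟨v, hv, ?_⟩
      by_cases hvP : v ∈ P
      · exact Or.inl hvP
      · exact Or.inr ⟨hv' hvP, fun h => hR w ((show v = w from h) ▸ hv)⟩
    · by_cases hwF : w ∈ F
      · exact Or.inl ⟨hwF, hwf⟩
      · obtain hw' | ⟨v, hv, hv'⟩ := hF w hw
        · exact absurd hw' hwF
        · refine Or.inr ⟨v, hv, hv'.imp_right fun hvF => ⟨hvF, fun h => ?_⟩⟩
          exact h2 w hw hwF ((show v = f from h) ▸ hv)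
  exact (hmin ⟨Set.sdiff_subset.trans hFS, hdom⟩ Set.sdiff_subset hf).2 rfl

/-- A walk from `u` to `v` that avoids the edge `uv` has a first edge, and it leads elsewhere. -/
theorem Bridgeless.exists_adj_ne {V : Type*} {G : SimpleGraph V} (h : G.Bridgeless) {u v : V}
    (huv : G.Adj u v) : ∃ w, w ≠ v ∧ G.Adj u w := by
  have hb := h s(u, v) huv
  rw [isBridge_iff, not_not] at hb
  obtain ⟨p⟩ := hb
  cases p with
  | nil => exact absurd huv (G.irrefl)
  | cons hw _ =>
    rw [deleteEdges_adj] at hw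
    exact ⟨_, fun h => hw.2 (by simp [h]), hw.1⟩

theorem Adj.dist_le_dist_add_one {V : Type*} {G : SimpleGraph V} (hG : G.Connected) {u v : V}
    (h : G.Adj u v) (x : V) : G.dist x u ≤ G.dist x v + 1 ∧ G.dist x v ≤ G.dist x u + 1 := by
  have h1 := hG.dist_triangle (u := x) (v := v) (w := u)
  have h2 := hG.dist_triangle (u := x) (v := u) (w := v)
  have h3 := dist_eq_one_iff_adj.2 h
  have h4 := dist_eq_one_iff_adj.2 h.symm
  omega

theorem Connected.exists_adj_dist_eq {V : Type*} {G : SimpleGraph V} (hG : G.Connected)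
    {x v : V} {n : ℕ} (h : G.dist x v = n + 1) : ∃ u, G.Adj v u ∧ G.dist x u = n := by
  obtain ⟨p, hp⟩ := hG.exists_walk_length_eq_dist v x
  rw [dist_comm, h] at hp
  cases p with
  | nil => simp at hp
  | @cons _ u _ hu q =>
    have h1 := dist_le q
    have h2 := (hu.dist_le_dist_add_one hG x)
    rw [Walk.length_cons] at hp
    rw [dist_comm] at h1
    exact ⟨u, hu, by omega⟩

/-! ### Every edge in a triangle -/

/-- If every edge lies in a triangle, the diameter-3 bound holds: each distance level of a
breadth-first search contributes three colours. -/
theorem rainbowConnectionNumber_le_nine_of_triangles {V : Type*} [Finite V] {G : SimpleGraph V}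
    (hG : G.Connected) (hdist : ∀ u v, G.dist u v ≤ 3)
    (htri : ∀ u v, G.Adj u v → ∃ w, G.Adj u w ∧ G.Adj v w) :
    G.rainbowConnectionNumber ≤ 9 := by
  classical
  obtain ⟨x⟩ := hG.nonempty
  let d := G.dist x
  have hstep {u v} (h : G.Adj u v) := h.dist_le_dist_add_one hG x
  let IsUp (v u : V) : Prop := G.Adj v u ∧ d v = d u + 1
  let T : Set V := {v | ∃ u u', u ≠ u' ∧ IsUp v u ∧ IsUp v u'}
  let W : Set V := {v | 0 < d v ∧ v ∉ T}
  let R (u v : V) : Prop := G.Adj u v ∧ d u = d v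
  have hup : ∀ v, 0 < d v → ∃ u, IsUp v u := by
    intro v hv
    obtain ⟨u, hu, hd⟩ := hG.exists_adj_dist_eq (x := x) (v := v) (n := d v - 1)
      (show d v = _ by omega)
    exact ⟨u, hu, show d v = d u + 1 by have : d u = d v - 1 := hd; omega⟩
  have hnbr : ∀ v ∈ W, ∃ u, R v u := by
    intro v hv
    obtain ⟨u, hu, hd⟩ := hup v hv.1
    obtain ⟨w, hvw, huw⟩ := htri v u hu
    refine ⟨w, hvw, ?_⟩
    -- The third vertex of a triangle on an upward edge lies on one of the two levels; on the upper
    -- one it would be a second upward neighbour and put `v` in `T`.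
    by_contra hne
    refine hv.2 ⟨u, w, huw.ne, ⟨hu, hd⟩, hvw, ?_⟩
    have h1 : d v ≤ d w + 1 ∧ d w ≤ d v + 1 := hstep hvw
    have h2 : d u ≤ d w + 1 ∧ d w ≤ d u + 1 := hstep huw
    omega
  -- Vertices of `T` dominate for free: they can mark one upward edge and still keep another
  -- unmarked.
  obtain ⟨F₀, hF₀W, hF₀, hpriv⟩ := exists_minimal_dominating R (fun v h => G.irrefl h.1) W W T
    (fun w hw => Or.inl hw)
  let F := F₀ ∪ T
  have hFpos : ∀ v ∈ F, 0 < d v := by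
    rintro v (hv | ⟨u, -, -, hu, -⟩)
    · exact (hF₀W hv).1
    · have := hu.2
      omega
  choose! π hπ using fun v (hv : v ∈ F) => hup v (hFpos v hv)
  -- Between levels `n` and `n + 1` an edge has colour `3n`, or `3n + 1` if marked; inside level `n
  -- + 1` it has `3n + 2`. The truncated value for `i = j = 0` is harmless, since level 0 is `x`
  -- alone.
  let col (i j : ℕ) (b : Prop) : Fin 9 :=
    if i = j then Fin.ofNat 9 (3 * i - 1) else if b then Fin.ofNat 9 (3 * max i j - 2)
      else Fin.ofNat 9 (3 * max i j - 3)
  let f : Sym2 V → Fin 9 := Sym2.lift ⟨fun u v => col (d u) (d v)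
    ((u ∈ F ∧ π u = v) ∨ (v ∈ F ∧ π v = u)), fun u v => by
      simp only [col, max_comm, eq_comm (a := d u), or_comm]
      split_ifs with h <;> simp_all⟩
  have hup_col : ∀ u v, IsUp u v → f s(u, v) =
      if u ∈ F ∧ π u = v then Fin.ofNat 9 (3 * d v + 1) else Fin.ofNat 9 (3 * d v) := by
    intro u v huv
    have h1 : ¬ (v ∈ F ∧ π v = u) := by
      rintro ⟨hv, rfl⟩
      have h2 := (hπ v hv).2
      have h3 := huv.2
      omega
    have h4 := huv.2
    simp only [f, Sym2.lift_mk, col, h1, or_false, h4, Nat.succ_ne_self, if_false,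
      max_eq_left (Nat.le_succ _)]
    rfl
  have hR_col : ∀ u v, R u v → f s(u, v) = Fin.ofNat 9 (3 * d u - 1) := by
    intro u v huv
    simp [f, col, huv.2]
  have hmark : ∀ v ∈ F, IsUp v (π v) ∧ f s(v, π v) = Fin.ofNat 9 (3 * d (π v) + 1) :=
    fun v hv => ⟨hπ v hv, by rw [hup_col _ _ (hπ v hv), if_pos ⟨hv, rfl⟩]⟩
  have hunmark : ∀ v, 0 < d v → v ∉ F₀ → ∃ u, IsUp v u ∧ f s(v, u) = Fin.ofNat 9 (3 * d u) := by
    intro v hv hvF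
    by_cases hvT : v ∈ T
    · obtain ⟨u, u', hne, hu, hu'⟩ := hvT
      by_cases h : π v = u
      · exact ⟨u', hu', by rw [hup_col _ _ hu', if_neg (fun h' => hne (h.symm.trans h'.2))]⟩
      · exact ⟨u, hu, by rw [hup_col _ _ hu, if_neg (fun h' => h h'.2)]⟩
    · obtain ⟨u, hu⟩ := hup v hv
      exact ⟨u, hu, by rw [hup_col _ _ hu, if_neg (fun h' => h'.1.elim hvF hvT)]⟩
  have hup_a : ∀ n < 3, ∀ v, d v = n + 1 → ∃ u, d u = n ∧
      G.RainbowLink f v u (if v ∈ F₀ then {Fin.ofNat 9 (3 * n), Fin.ofNat 9 (3 * n + 2)}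
        else {Fin.ofNat 9 (3 * n)}) := by
    intro n hn v hv
    by_cases hvF : v ∈ F₀
    · obtain ⟨r, hr, hrF⟩ : ∃ r, R v r ∧ r ∉ F₀ := by
        rcases hpriv v hvF with ⟨hW, h⟩ | ⟨r, -, h, hr⟩
        · obtain ⟨r, hr⟩ := hnbr v hW
          exact ⟨r, hr, (h r hr).2⟩
        · exact ⟨r, ⟨hr.1.symm, hr.2.symm⟩, h⟩
      obtain ⟨u, hu, hc⟩ := hunmark r (by have := hr.2; omega) hrF
      have hd : d u = n := by have h1 := hr.2; have h2 := hu.2; omega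
      rw [hd] at hc
      refine ⟨u, hd, ?_⟩
      rw [if_pos hvF]
      refine .cons hr.1 (hR_col _ _ hr) (.single hu.1 hc) ?_ ?_
      · rw [hv]
        interval_cases n <;> decide
      · rw [hv]
        interval_cases n <;> decide
    · obtain ⟨u, hu, hc⟩ := hunmark v (by omega) hvF
      have hd : d u = n := by have h2 := hu.2; omega
      rw [hd] at hc
      exact ⟨u, hd, by rw [if_neg hvF]; exact .single hu.1 hc⟩
  have hup_b : ∀ n < 3, ∀ v, d v = n + 1 → ∃ u, d u = n ∧
      G.RainbowLink f v u (if v ∈ F₀ then {Fin.ofNat 9 (3 * n + 1)}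
        else {Fin.ofNat 9 (3 * n + 1), Fin.ofNat 9 (3 * n + 2)}) := by
    intro n hn v hv
    by_cases hvF : v ∈ F
    · obtain ⟨hu, hc⟩ := hmark v hvF
      have hd : d (π v) = n := by have h2 := hu.2; omega
      rw [hd] at hc
      refine ⟨_, hd, (RainbowLink.single hu.1 hc).mono ?_⟩
      split_ifs <;> simp
    · obtain ⟨r, hr, hrF⟩ : ∃ r, R v r ∧ r ∈ F := by
        rcases hF₀ v ⟨by omega, fun h => hvF (Or.inr h)⟩ with h | ⟨r, hr, h⟩
        · exact absurd (Or.inl h) hvF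
        · exact ⟨r, hr, h.symm⟩
      obtain ⟨hu, hc⟩ := hmark r hrF
      have hd : d (π r) = n := by have h1 := hr.2; have h2 := hu.2; omega
      rw [hd] at hc
      refine ⟨_, hd, ?_⟩
      rw [if_neg (fun h => hvF (Or.inl h))]
      refine .cons hr.1 (hR_col _ _ hr) (.single hu.1 hc) ?_ ?_
      · rw [hv]
        interval_cases n <;> decide
      · rw [hv]
        interval_cases n <;> decide
  let L (n : ℕ) : Finset (Fin 9) := Finset.univ.filter fun c => c.val < 3 * n
  have hL : ∀ n < 3, ∀ s : Finset (Fin 9),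
      s ⊆ {Fin.ofNat 9 (3 * n), Fin.ofNat 9 (3 * n + 1), Fin.ofNat 9 (3 * n + 2)} →
      Disjoint s (L n) ∧ s ⊆ L (n + 1) := by
    intro n hn s hs
    have : Disjoint ({Fin.ofNat 9 (3 * n), Fin.ofNat 9 (3 * n + 1), Fin.ofNat 9 (3 * n + 2)} :
        Finset (Fin 9)) (L n) ∧ ({Fin.ofNat 9 (3 * n), Fin.ofNat 9 (3 * n + 1),
        Fin.ofNat 9 (3 * n + 2)} : Finset (Fin 9)) ⊆ L (n + 1) := by
      interval_cases n <;> decide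
    exact ⟨this.1.mono_left hs, hs.trans this.2⟩
  have hLmono : ∀ n, L n ⊆ L (n + 1) := by
    intro n c hc
    simp only [L, Finset.mem_filter, Finset.mem_univ, true_and] at hc ⊢
    omega
  -- The a-route needs `3n + 2` exactly from `F₀`, the b-route exactly from outside it. They clash
  -- only if `u` is in `F₀` and `v` is not, and then exchanging the two roles helps.
  have hAB : ∀ n < 3, ∀ b b' : Prop, ((¬ b) ∨ b') → Disjoint
      (if b then {Fin.ofNat 9 (3 * n), Fin.ofNat 9 (3 * n + 2)} else {Fin.ofNat 9 (3 * n)} :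
        Finset (Fin 9))
      (if b' then {Fin.ofNat 9 (3 * n + 1)} else {Fin.ofNat 9 (3 * n + 1),
        Fin.ofNat 9 (3 * n + 2)}) := by
    intro n hn b b' h
    by_cases hb : b <;> by_cases hb' : b' <;> simp only [hb, hb', if_true, if_false] <;>
      first | (exfalso; tauto) | (interval_cases n <;> decide)
  have key : ∀ n ≤ 3, ∀ u v, d u ≤ n → d v ≤ n → G.RainbowLink f u v (L n) := by
    intro n
    induction n with
    | zero =>
      intro _ u v hu hv
      have hx : ∀ w, d w ≤ 0 → w = x := fun w hw =>
        (hG.dist_eq_zero_iff.1 (Nat.le_zero.1 hw)).symm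
      rw [hx u hu, hx v hv]
      exact .refl _ _
    | succ n ih =>
      intro hn u v hu hv
      replace ih := ih (by omega)
      have hn' : n < 3 := by omega
      have hsA : ∀ b : Prop, (if b then {Fin.ofNat 9 (3 * n), Fin.ofNat 9 (3 * n + 2)} else
          {Fin.ofNat 9 (3 * n)} : Finset (Fin 9)) ⊆
          {Fin.ofNat 9 (3 * n), Fin.ofNat 9 (3 * n + 1), Fin.ofNat 9 (3 * n + 2)} := by
        intro b c
        split_ifs <;> simp only [Finset.mem_insert, Finset.mem_singleton] <;> tauto
      have hsB : ∀ b : Prop, (if b then {Fin.ofNat 9 (3 * n + 1)} else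
          {Fin.ofNat 9 (3 * n + 1), Fin.ofNat 9 (3 * n + 2)} : Finset (Fin 9)) ⊆
          {Fin.ofNat 9 (3 * n), Fin.ofNat 9 (3 * n + 1), Fin.ofNat 9 (3 * n + 2)} := by
        intro b c
        split_ifs <;> simp only [Finset.mem_insert, Finset.mem_singleton] <;> tauto
      have top_low : ∀ u v, d u = n + 1 → d v ≤ n → G.RainbowLink f u v (L (n + 1)) := by
        intro u v hu hv
        obtain ⟨u', hu', hlink⟩ := hup_a n hn' u hu
        obtain ⟨h1, h2⟩ := hL n hn' _ (hsA (u ∈ F₀))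
        exact (hlink.trans (ih u' v hu'.le hv) h1).mono (Finset.union_subset h2 (hLmono n))
      have top_top : ∀ u v, d u = n + 1 → d v = n + 1 → (u ∉ F₀ ∨ v ∈ F₀) →
          G.RainbowLink f u v (L (n + 1)) := by
        intro u v hu hv huv
        obtain ⟨u', hu', hlink⟩ := hup_a n hn' u hu
        obtain ⟨v', hv', hlink'⟩ := hup_b n hn' v hv
        obtain ⟨h1, h2⟩ := hL n hn' _ (hsA (u ∈ F₀))
        obtain ⟨h3, h4⟩ := hL n hn' _ (hsB (v ∈ F₀))
        refine ((hlink.trans (ih u' v' hu'.le hv'.le) h1).trans hlink'.symm ?_).mono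
          (Finset.union_subset (Finset.union_subset h2 (hLmono n)) h4)
        rw [Finset.disjoint_union_left]
        exact ⟨hAB n hn' _ _ huv, h3.symm⟩
      rcases Nat.lt_or_ge (d u) (n + 1) with h1 | h1 <;>
        rcases Nat.lt_or_ge (d v) (n + 1) with h2 | h2
      · exact (ih u v (by omega) (by omega)).mono (hLmono n)
      · exact (top_low v u (by omega) (by omega)).symm
      · exact top_low u v (by omega) (by omega)
      · by_cases h : u ∉ F₀ ∨ v ∈ F₀
        · exact top_top u v (by omega) (by omega) h
        · exact (top_top v u (by omega) (by omega) (by tauto)).symm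
  exact rainbowConnectionNumber_le_of_rainbowLink
    fun u v => ⟨_, key 3 le_rfl u v (hdist x u) (hdist x v)⟩

/-! ### Distance cells around an edge in no triangle -/

section EdgeRoot

variable {V : Type*} {G : SimpleGraph V} {x y : V}

/-- The vertices at distance `i` from `x` and `j` from `y`. -/
def distCell (G : SimpleGraph V) (x y : V) (i j : ℕ) : Set V :=
  {v | G.dist x v = i ∧ G.dist y v = j}

/-- A connected graph with minimum degree at least two and all distances at most three, together
with an edge `xy` in no triangle. -/
structure IsTriangleFreeEdge (G : SimpleGraph V) (x y : V) : Prop where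
  connected : G.Connected
  dist_le (u v : V) : G.dist u v ≤ 3
  exists_adj_ne {u v : V} (h : G.Adj u v) : ∃ w, w ≠ v ∧ G.Adj u w
  adj : G.Adj x y
  not_adj {w : V} (h : G.Adj x w) : ¬ G.Adj y w

namespace IsTriangleFreeEdge

theorem symm (h : G.IsTriangleFreeEdge x y) : G.IsTriangleFreeEdge y x :=
  { h with
    adj := h.adj.symm
    not_adj := fun h1 h2 => h.not_adj h2 h1 }

theorem step (h : G.IsTriangleFreeEdge x y) {u v : V} (huv : G.Adj u v) :
    (G.dist x u ≤ G.dist x v + 1 ∧ G.dist x v ≤ G.dist x u + 1) ∧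
      (G.dist y u ≤ G.dist y v + 1 ∧ G.dist y v ≤ G.dist y u + 1) :=
  ⟨huv.dist_le_dist_add_one h.connected x, huv.dist_le_dist_add_one h.connected y⟩

theorem dist_pos (h : G.IsTriangleFreeEdge x y) {v : V} : 0 < G.dist x v ↔ v ≠ x := by
  rw [Nat.pos_iff_ne_zero, Ne, h.connected.dist_eq_zero_iff, ne_comm]

/-- Every vertex lies in one of eight distance cells. -/
theorem cell_cases (h : G.IsTriangleFreeEdge x y) (v : V) :
    v ∈ G.distCell x y 0 1 ∨ v ∈ G.distCell x y 1 0 ∨ v ∈ G.distCell x y 1 2 ∨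
    v ∈ G.distCell x y 2 1 ∨ v ∈ G.distCell x y 2 2 ∨ v ∈ G.distCell x y 2 3 ∨
    v ∈ G.distCell x y 3 2 ∨ v ∈ G.distCell x y 3 3 := by
  have h1 := h.dist_le x v
  have h2 := h.dist_le y v
  have h3 := h.adj.dist_le_dist_add_one h.connected v
  rw [dist_comm (u := v), dist_comm (u := v)] at h3
  have h4 : ¬ (G.dist x v = 1 ∧ G.dist y v = 1) := fun ⟨h5, h6⟩ =>
    h.not_adj (dist_eq_one_iff_adj.1 h5) (dist_eq_one_iff_adj.1 h6)
  have h7 : ¬ (G.dist x v = 0 ∧ G.dist y v = 0) := fun ⟨h5, h6⟩ =>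
    h.adj.ne ((h.connected.dist_eq_zero_iff.1 h5).trans (h.connected.dist_eq_zero_iff.1 h6).symm)
  simp only [distCell, Set.mem_ofPred_eq]
  omega

theorem eq_left (h : G.IsTriangleFreeEdge x y) {v : V} {j : ℕ} (hv : v ∈ G.distCell x y 0 j) :
    v = x :=
  (h.connected.dist_eq_zero_iff.1 hv.1).symm

theorem mem_cell_symm {v : V} {i j : ℕ} : v ∈ G.distCell y x j i ↔ v ∈ G.distCell x y i j :=
  and_comm

/-! ### Marked sets in the cells, and crossing to the other root -/

/-- Vertices of the cell `(1, 2)` whose only neighbours are `x` and vertices of the same cell. -/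
def innerNear (G : SimpleGraph V) (x y : V) : Set V :=
  {v | v ∈ G.distCell x y 1 2 ∧ ∀ w, G.Adj v w → w = x ∨ w ∈ G.distCell x y 1 2}

/-- If a chosen vertex is undominated by the others, its second neighbour lies in the same cell,
since `x` is its only neighbour outside, and is not chosen. -/
theorem exists_innerNear_marking [Finite V] (h : G.IsTriangleFreeEdge x y) :
    ∃ F ⊆ innerNear G x y,
      (∀ v ∈ innerNear G x y, v ∉ F → ∃ w ∈ F, G.Adj v w) ∧
      ∀ f ∈ F, ∃ r ∈ G.distCell x y 1 2, r ∉ F ∧ G.Adj f r := by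
  obtain ⟨F, hFS, hF, hpriv⟩ := exists_minimal_dominating G.Adj (fun _ => G.irrefl)
    (innerNear G x y) (innerNear G x y) ∅ (fun _ hw => Or.inl hw)
  refine ⟨F, hFS, fun v hv hvF => ?_, fun f hf => ?_⟩
  · obtain h1 | ⟨w, hw, h1 | h1⟩ := hF v hv
    · exact absurd h1 hvF
    · exact absurd h1 (Set.notMem_empty _)
    · exact ⟨w, h1, hw⟩
  · obtain ⟨hfW, hf'⟩ | ⟨r, hr, hrF, hadj⟩ := hpriv f hf
    · obtain ⟨w, hwx, hw⟩ := h.exists_adj_ne (dist_eq_one_iff_adj.1 hfW.1.1).symm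
      exact ⟨w, (hfW.2 w hw).resolve_left hwx, (hf' w hw).2, hw⟩
    · exact ⟨r, hr.1, hrF, hadj.symm⟩

/-- Vertices of the cell `(2, 3)` whose only neighbours are in the cells `(1, 2)` and `(2, 3)`. -/
def innerFar (G : SimpleGraph V) (x y : V) : Set V :=
  {v | v ∈ G.distCell x y 2 3 ∧
    ∀ w, G.Adj v w → w ∈ G.distCell x y 1 2 ∨ w ∈ G.distCell x y 2 3}

/-- A mark must lead into `T`, from where the other root can be reached, so only vertices with a
neighbour in `T` are candidates; cell vertices outside `innerFar` dominate for free. The last clause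
keeps a way to `x` open once the edge to `a` is marked. -/
theorem exists_innerFar_marking [Finite V] (h : G.IsTriangleFreeEdge x y) (T : Set V)
    (hT : ∀ u ∈ innerFar G x y, (∃ a ∈ T, G.Adj u a) ∨
      ∃ v ∈ G.distCell x y 2 3, G.Adj u v ∧ (v ∈ innerFar G x y → ∃ a ∈ T, G.Adj v a)) :
    ∃ F ⊆ innerFar G x y, (∀ f ∈ F, ∃ a ∈ T, G.Adj f a) ∧
      (∀ v ∈ innerFar G x y, v ∉ F →
        ∃ w ∈ G.distCell x y 2 3, G.Adj v w ∧ (w ∉ innerFar G x y ∨ w ∈ F)) ∧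
      ∀ f ∈ F, ∀ a, (∃ a' ∈ G.distCell x y 1 2, a' ≠ a ∧ G.Adj f a') ∨
        ∃ r ∈ G.distCell x y 2 3, r ∉ F ∧ G.Adj f r := by
  obtain ⟨F, hFS, hF, hpriv⟩ := exists_minimal_dominating G.Adj (fun _ => G.irrefl)
    (innerFar G x y) {v | v ∈ innerFar G x y ∧ ∃ a ∈ T, G.Adj v a}
    (G.distCell x y 2 3 \ innerFar G x y) (by
      intro w hw
      obtain h1 | ⟨v, hv, hwv, h1⟩ := hT w hw
      · exact Or.inl ⟨hw, h1⟩
      · refine Or.inr ⟨v, hwv, ?_⟩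
        by_cases hvW : v ∈ innerFar G x y
        · exact Or.inr ⟨hvW, h1 hvW⟩
        · exact Or.inl ⟨hv, hvW⟩)
  refine ⟨F, fun f hf => (hFS hf).1, fun f hf => (hFS hf).2, fun v hv hvF => ?_, fun f hf a => ?_⟩
  · obtain h1 | ⟨w, hw, h1 | h1⟩ := hF v hv
    · exact absurd h1 hvF
    · exact ⟨w, h1.1, hw, Or.inl h1.2⟩
    · exact ⟨w, (hFS h1).1.1, hw, Or.inr h1⟩
  · obtain ⟨hfW, hf'⟩ | ⟨r, hr, hrF, hadj⟩ := hpriv f hf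
    · obtain ⟨w, hwa, hw⟩ : ∃ w, w ≠ a ∧ G.Adj f w := by
        obtain ⟨a₀, -, ha₀⟩ := (hFS hf).2
        by_cases haa : a₀ = a
        · subst haa
          exact h.exists_adj_ne ha₀
        · exact ⟨a₀, haa, ha₀⟩
      obtain h1 | h1 := hfW.2 w hw
      · exact Or.inl ⟨w, h1, hwa, hw⟩
      · exact Or.inr ⟨w, h1, (hf' w hw).2, hw⟩
    · exact Or.inr ⟨r, hr.1, hrF, hadj.symm⟩

/-- Vertices of the cell `(1, 2)` with a neighbour in the cell `(2, 1)`. -/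
def crossNear (G : SimpleGraph V) (x y : V) : Set V :=
  {a | a ∈ G.distCell x y 1 2 ∧ ∃ b ∈ G.distCell x y 2 1, G.Adj a b}

/-- Vertices of the cell `(1, 2)` with a walk of length at most two to the cell `(2, 1)`, not
through `x`. -/
def reachNear (G : SimpleGraph V) (x y : V) : Set V :=
  {a | a ∈ G.distCell x y 1 2 ∧ (a ∈ crossNear G x y ∨
    (∃ c ∈ G.distCell x y 2 2, G.Adj a c) ∨ ∃ a' ∈ crossNear G x y, G.Adj a a')}

/-- Treats distances two and three together; `s = t` is distance two. -/
theorem exists_middle (h : G.IsTriangleFreeEdge x y) (u w : V) (huw : u ≠ w)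
    (hadj : ¬ G.Adj u w) : ∃ s t, G.Adj u s ∧ (s = t ∨ G.Adj s t) ∧ G.Adj t w := by
  obtain ⟨p, hp⟩ := h.connected.exists_walk_length_eq_dist u w
  have hlen := h.dist_le u w
  rw [← hp] at hlen
  match p, hlen with
  | .nil, _ => exact absurd rfl huw
  | .cons h1 .nil, _ => exact absurd h1 hadj
  | .cons h1 (.cons h2 .nil), _ => exact ⟨_, _, h1, Or.inl rfl, h2⟩
  | .cons h1 (.cons h2 (.cons h3 .nil)), _ => exact ⟨_, _, h1, Or.inr h2, h3⟩
  | .cons h1 (.cons h2 (.cons h3 (.cons h4 p))), hlen =>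
    simp only [Walk.length_cons] at hlen
    omega

/-- Take a neighbour `b ≠ x` of `y` and a walk of length at most three from `u` to `b`. Its second
vertex is in (1,2), hence in `reachNear`, or in (2,3); in the latter case, if that vertex is inner,
the next one is in (1,2) and adjacent to `b`. -/
theorem reachNear_dominates (h : G.IsTriangleFreeEdge x y) (u : V) (hu : u ∈ innerFar G x y) :
    (∃ a ∈ reachNear G x y, G.Adj u a) ∨
      ∃ v ∈ G.distCell x y 2 3, G.Adj u v ∧
        (v ∈ innerFar G x y → ∃ a ∈ reachNear G x y, G.Adj v a) := by
  obtain ⟨b, hbx, hyb⟩ := h.exists_adj_ne h.adj.symm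
  have hb : b ∈ G.distCell x y 2 1 := by
    have h1 : G.dist y b = 1 := dist_eq_one_iff_adj.2 hyb
    have h2 : b ≠ x := hbx
    have := h.cell_cases b
    have h3 : G.dist x b ≠ 0 := fun h4 => h2 (h.connected.dist_eq_zero_iff.1 h4).symm
    simp only [distCell, Set.mem_ofPred_eq] at this ⊢
    omega
  obtain ⟨p, q, hup, hpq, hqb⟩ := h.exists_middle u b
    (by rintro rfl; have := hu.1.2; have := hb.2; omega)
    (fun hub => by have := h.step hub; have := hu.1.2; have := hb.2; omega)
  have hqb' := h.step hqb
  obtain ⟨hb1, hb2⟩ := hb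
  have hq0 : G.dist y q ≠ 0 ∨ p = q ∨ G.dist y p ≤ 1 := by
    obtain rfl | hpq := hpq
    · exact Or.inr (Or.inl rfl)
    · have := h.step hpq
      omega
  obtain hp | hp := hu.2 p hup
  · refine Or.inl ⟨p, ⟨hp, ?_⟩, hup⟩
    obtain ⟨hp1, hp2⟩ := hp
    obtain rfl | hpq := hpq
    · exact Or.inl ⟨⟨hp1, hp2⟩, b, ⟨hb1, hb2⟩, hqb⟩
    · have hs := h.step hpq
      rcases h.cell_cases q with hq | hq | hq | hq | hq | hq | hq | hq
      · obtain ⟨h1, h2⟩ := hq; omega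
      · obtain ⟨h1, h2⟩ := hq; omega
      · exact Or.inr (Or.inr ⟨q, ⟨hq, b, ⟨hb1, hb2⟩, hqb⟩, hpq⟩)
      · exact Or.inl ⟨⟨hp1, hp2⟩, q, hq, hpq⟩
      · exact Or.inr (Or.inl ⟨q, hq, hpq⟩)
      · obtain ⟨h1, h2⟩ := hq; omega
      · obtain ⟨h1, h2⟩ := hq; omega
      · obtain ⟨h1, h2⟩ := hq; omega
  · refine Or.inr ⟨p, hp, hup, fun hpW => ?_⟩
    obtain ⟨hp1, hp2⟩ := hp
    obtain rfl | hpq := hpq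
    · omega
    · obtain hq | hq := hpW.2 q hpq
      · exact ⟨q, ⟨hq, Or.inl ⟨hq, b, ⟨hb1, hb2⟩, hqb⟩⟩, hpq⟩
      · obtain ⟨h1, h2⟩ := hq; omega

/-- The hypothesis of `exists_innerFar_marking` for the vertices of `crossNear`. -/
def CrossDominates (G : SimpleGraph V) (x y : V) : Prop :=
  ∀ u ∈ innerFar G x y, (∃ a ∈ crossNear G x y, G.Adj u a) ∨
      ∃ v ∈ G.distCell x y 2 3, G.Adj u v ∧
        (v ∈ innerFar G x y → ∃ a ∈ crossNear G x y, G.Adj v a)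

/-- Let `u` and `w` be counterexamples on the two sides and join them by a walk of length at most
three. It must leave the cells (1,2), (2,3) for (2,1), (3,2) in its middle edge. From (1,2) this is
a cross edge next to `u`; from (2,3) it is impossible, as all neighbours of `u` there are inner. -/
theorem crossDominates_or (h : G.IsTriangleFreeEdge x y) :
    CrossDominates G x y ∨ CrossDominates G y x := by
  by_contra! hcon
  simp only [CrossDominates, not_forall, not_or, not_exists, not_and] at hcon
  obtain ⟨⟨u, hu, hu1, hu2⟩, w, hw, -, hw2⟩ := hcon
  have hu3 : ∀ v, G.Adj u v → v ∈ G.distCell x y 2 3 → v ∈ innerFar G x y := by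
    intro v hv hvc
    exact (hu2 v hvc hv).1
  have hw3 : ∀ v, G.Adj w v → v ∈ G.distCell y x 2 3 → v ∈ innerFar G y x := by
    intro v hv hvc
    exact (hw2 v hvc hv).1
  obtain ⟨hux, huy⟩ := hu.1
  obtain ⟨hwy, hwx⟩ := hw.1
  obtain ⟨s, t, hus, hst, htw⟩ := h.exists_middle u w (by rintro rfl; omega) (fun huw => by
    rcases hu.2 w huw with ⟨h1, h2⟩ | ⟨h1, h2⟩ <;> omega)
  have ht := hw.2 t htw.symm
  rcases hu.2 s hus with hs | hs
  · obtain ⟨hs1, hs2⟩ := hs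
    rcases ht with ht | ht
    · obtain ⟨ht1, ht2⟩ := ht
      obtain rfl | hst := hst
      · omega
      · exact hu1 s ⟨⟨hs1, hs2⟩, t, ⟨ht2, ht1⟩, hst⟩ hus
    · obtain ⟨ht1, ht2⟩ := ht
      obtain rfl | hst := hst
      · omega
      · have := h.step hst
        omega
  · have hsW := hu3 s hus hs
    obtain ⟨hs1, hs2⟩ := hs
    obtain rfl | hst := hst
    · rcases ht with ⟨h1, h2⟩ | ⟨h1, h2⟩ <;> omega
    · rcases ht with ⟨h1, h2⟩ | ⟨h1, h2⟩ <;> rcases hsW.2 t hst with ⟨h3, h4⟩ | ⟨h3, h4⟩ <;> omega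

/-- Vertices of the cell `(3, 3)` with no neighbour in `(3, 2)` and at most one neighbour in
`(2, 2)` and `(2, 3)`. -/
def innerDeep (G : SimpleGraph V) (x y : V) : Set V :=
  {v | v ∈ G.distCell x y 3 3 ∧ (∀ w ∈ G.distCell x y 3 2, ¬ G.Adj v w) ∧
    ∀ w w', G.Adj v w → G.Adj v w' → G.dist x w = 2 → G.dist x w' = 2 → w = w'}

/-- An undominated chosen vertex has a neighbour besides its only one at distance 2 from `x`. That
neighbour stays in (3,3), and it is inner, since non-inner vertices dominate. -/
theorem exists_innerDeep_marking [Finite V] (h : G.IsTriangleFreeEdge x y) :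
    ∃ F ⊆ innerDeep G x y,
      (∀ v ∈ innerDeep G x y, v ∉ F → ∃ w ∈ G.distCell x y 3 3, G.Adj v w ∧
        (w ∉ innerDeep G x y ∨ w ∈ F)) ∧
      ∀ f ∈ F, ∃ r ∈ innerDeep G x y, r ∉ F ∧ G.Adj f r := by
  obtain ⟨F, hFS, hF, hpriv⟩ := exists_minimal_dominating G.Adj (fun _ => G.irrefl)
    (innerDeep G x y) (innerDeep G x y) (G.distCell x y 3 3 \ innerDeep G x y)
    (fun _ hw => Or.inl hw)
  refine ⟨F, hFS, fun v hv hvF => ?_, fun f hf => ?_⟩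
  · obtain h1 | ⟨w, hw, h1 | h1⟩ := hF v hv
    · exact absurd h1 hvF
    · exact ⟨w, h1.1, hw, Or.inl h1.2⟩
    · exact ⟨w, (hFS h1).1, hw, Or.inr h1⟩
  · obtain ⟨hfW, hf'⟩ | ⟨r, hr, hrF, hadj⟩ := hpriv f hf
    · obtain ⟨c, hc, hcd⟩ := h.connected.exists_adj_dist_eq (n := 2) hfW.1.1
      obtain ⟨w, hwc, hw⟩ := h.exists_adj_ne hc
      have hwD : w ∈ G.distCell x y 3 3 := by
        have h1 : G.dist x w ≠ 2 := fun h2 => hwc (hfW.2.2 w c hw hc h2 hcd)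
        have h3 := hfW.2.1 w
        have h4 := h.step hw
        have h5 := hfW.1
        have h6 := h.cell_cases w
        simp only [distCell, Set.mem_ofPred_eq] at h3 h5 h6 ⊢
        have h7 : ¬ (G.dist x w = 3 ∧ G.dist y w = 2) := fun h8 => h3 h8 hw
        omega
      obtain ⟨h1, h2⟩ := hf' w hw
      exact ⟨w, by_contra fun h3 => h1 ⟨hwD, h3⟩, h2, hw⟩
    · exact ⟨r, hr, hrF, hadj.symm⟩

/-! ### The colouring and the route profiles -/

open Classical in
/-- The index of the distance cell of a vertex; `innerNear` has an index of its own. -/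
noncomputable def cellRank (G : SimpleGraph V) (x y v : V) : ℕ :=
  match G.dist x v, G.dist y v with
  | 0, _ => 0
  | 1, 0 => 1
  | 1, _ => if v ∈ innerNear G x y then 2 else 3
  | 2, 1 => 4
  | 2, 2 => 5
  | 2, _ => 6
  | _, 2 => 7
  | _, _ => 8

/-- The colour of an unmarked edge between cells of the given ranks, the lower one first. -/
def baseColor : ℕ → ℕ → Fin 9
  -- Ranks 0 to 8 are `x`, `y`, the inner and outer parts of (1,2), then (2,1), (2,2), (2,3), (3,2),
  -- (3,3). The cell (1,2) is split because a detour to `y` inside its outer part must avoid colour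
  -- 3, which is used on routes to `x`.
  | 0, 1 => 0
  | 0, _ => 1
  | 1, _ => 2
  | 2, _ => 3
  | 3, 3 => 6
  | 3, 6 => 3
  | 3, _ => 8
  | 4, _ => 4
  | 5, 7 => 6
  | 5, 8 => 5
  | 5, _ => 8
  | 6, 7 => 8
  | 6, 8 => 5
  | 7, 8 => 6
  | _, _ => 7

/-- The colour of a marked edge from a cell of the given rank to its lower neighbour. -/
def markedColor : ℕ → Fin 9
  | 2 => 5
  | 6 => 5
  | _ => 6

open Classical in
/-- The colouring in which each `u ∈ F` marks the edge from `u` to `π u`. -/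
noncomputable def cellColor (r : V → ℕ) (F : Set V) (π : V → V) : Sym2 V → Fin 9 :=
  Sym2.lift ⟨fun u v => if (u ∈ F ∧ π u = v) ∨ (v ∈ F ∧ π v = u) then
      markedColor (max (r u) (r v)) else baseColor (min (r u) (r v)) (max (r u) (r v)),
    fun u v => by simp only [max_comm, min_comm, or_comm]⟩

theorem cellColor_base {r : V → ℕ} {F : Set V} {π : V → V} (hπ : ∀ u ∈ F, r (π u) < r u)
    {u v : V} (huv : r v ≤ r u) (h : u ∈ F → π u ≠ v) :
    cellColor r F π s(u, v) = baseColor (r v) (r u) := by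
  have h1 : ¬ ((u ∈ F ∧ π u = v) ∨ (v ∈ F ∧ π v = u)) := by
    rintro (⟨h1, h2⟩ | ⟨h1, rfl⟩)
    · exact h h1 h2
    · have := hπ v h1
      omega
  simp only [cellColor, Sym2.lift_mk, if_neg h1, min_eq_right huv, max_eq_left huv]

theorem cellColor_marked {r : V → ℕ} {F : Set V} {π : V → V} (hπ : ∀ u ∈ F, r (π u) < r u)
    {u : V} (hu : u ∈ F) : cellColor r F π s(u, π u) = markedColor (r u) := by
  simp only [cellColor, Sym2.lift_mk, hu, true_and, true_or, if_true, max_eq_left (hπ u hu).le]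

/-- The colour sets of the routes to `x` (`false`) and to `y` (`true`) that the vertices have. -/
def routeProfiles : List (List (Bool × Finset (Fin 9))) :=
  -- In order: `x`; `y`; (1,2) outer, marked, inner unmarked; the same for (2,1); (2,2); (2,3)
  -- unmarked, marked; (3,2) unmarked, marked; (3,3) outside and inside the dominating set of
  -- `innerDeep`.
  [[(false, ∅)], [(true, ∅)],
    [(false, {1}), (true, {2, 3, 4, 5, 6, 7, 8})],
    [(false, {5}), (false, {3, 1})],
    [(false, {1}), (false, {3, 5})],
    [(true, {2}), (false, {1, 3, 4, 5, 6, 7, 8})],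
    [(true, {6}), (true, {4, 2})],
    [(true, {2}), (true, {4, 6})],
    [(false, {8, 1}), (true, {4, 2})],
    [(false, {3, 1}), (true, {2, 4, 5, 6, 7, 8})],
    [(false, {5, 1}), (false, {7, 3, 1}), (true, {2, 4, 5, 6, 8})],
    [(true, {4, 2}), (false, {1, 3, 5, 6, 7, 8})],
    [(true, {6, 2}), (true, {7, 4, 2}), (false, {6, 8, 1})],
    [(false, {5, 3, 8, 1}), (true, {7, 6, 4, 2})],
    [(false, {7, 5, 3, 8, 1}), (true, {6, 4, 2})]]

/-- Two vertices of the same kind are included. Routes to different roots are joined by `xy`, hence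
the condition on colour 0. -/
theorem routeProfiles_compatible : ∀ c ∈ routeProfiles, ∀ c' ∈ routeProfiles,
    ∃ r ∈ c, ∃ r' ∈ c', Disjoint r.2 r'.2 ∧ (r.1 = r'.1 ∨ (0 ∉ r.2 ∧ 0 ∉ r'.2)) := by
  decide

theorem exists_rainbowLink_of_profiles {f : Sym2 V → Fin 9} (hxy : G.Adj x y)
    (hf : f s(x, y) = 0)
    (hprof : ∀ v, ∃ c ∈ routeProfiles, ∀ r ∈ c, G.RainbowLink f v (if r.1 then y else x) r.2)
    (u v : V) : ∃ s, G.RainbowLink f u v s := by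
  obtain ⟨c, hc, hu⟩ := hprof u
  obtain ⟨c', hc', hv⟩ := hprof v
  obtain ⟨⟨b, s⟩, hr, ⟨b', s'⟩, hr', hdisj, h0⟩ := routeProfiles_compatible c hc c' hc'
  have h1 := hu _ hr
  have h2 := hv _ hr'
  obtain rfl | hbb := eq_or_ne b b'
  · exact ⟨_, h1.trans h2.symm hdisj⟩
  · obtain ⟨h3, h4⟩ := h0.resolve_left hbb
    have h5 : G.RainbowLink f (if b then y else x) (if b' then y else x) {0} := by
      cases b <;> cases b' <;> first | exact absurd rfl hbb | skip
      · exact .single hxy hf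
      · exact (RainbowLink.single hxy hf).symm
    refine ⟨_, (h1.trans h5 (by simpa using h3)).trans h2.symm ?_⟩
    rw [Finset.disjoint_union_left]
    exact ⟨hdisj, by simpa using h4⟩

/-! ### Nine colours around an edge in no triangle -/

theorem rainbowConnectionNumber_le_nine_of_crossDominates [Finite V]
    (h : G.IsTriangleFreeEdge x y) (hcross : CrossDominates G y x) :
    G.rainbowConnectionNumber ≤ 9 := by
  classical
  obtain ⟨FA, hFA, hFA_dom, hFA_nbr⟩ := h.exists_innerNear_marking
  obtain ⟨FB, hFB, hFB_dom, hFB_nbr⟩ := h.symm.exists_innerNear_marking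
  obtain ⟨FP, hFP, hFP_star, hFP_dom, hFP_nbr⟩ :=
    h.exists_innerFar_marking (reachNear G x y) h.reachNear_dominates
  obtain ⟨FQ, hFQ, hFQ_star, hFQ_dom, hFQ_nbr⟩ :=
    h.symm.exists_innerFar_marking (crossNear G y x) hcross
  obtain ⟨FD, hFD, hFD_dom, hFD_nbr⟩ := h.exists_innerDeep_marking
  -- These have two neighbours at distance 2 from `x`: one edge into (2,2) can be marked for the
  -- route to `y`, and another remains for `x`.
  let FE : Set V := {d | d ∈ G.distCell x y 3 3 ∧ (∀ w ∈ G.distCell x y 3 2, ¬ G.Adj d w) ∧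
    d ∉ innerDeep G x y}
  have hDC : ∀ d ∈ G.distCell x y 3 3, (∀ w ∈ G.distCell x y 3 2, ¬ G.Adj d w) →
      ∃ c ∈ G.distCell x y 2 2, G.Adj d c := by
    intro d hd hdQ
    obtain ⟨c, hc, hcd⟩ := h.connected.exists_adj_dist_eq (n := 2) hd.2
    refine ⟨c, ⟨?_, hcd⟩, hc⟩
    have h1 := h.step hc
    have h2 : G.dist x c ≠ 3 := fun h3 => hdQ c ⟨h3, hcd⟩ hc
    have h4 := h.dist_le x c
    have h5 := hd.1
    omega
  -- The marks.
  let Target (u v : V) : Prop := (u ∈ FA ∧ v = x) ∨ (u ∈ FB ∧ v = y) ∨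
    (u ∈ FP ∧ v ∈ reachNear G x y ∧ G.Adj u v) ∨ (u ∈ FQ ∧ v ∈ crossNear G y x ∧ G.Adj u v) ∨
    (u ∈ FE ∪ FD ∧ v ∈ G.distCell x y 2 2 ∧ G.Adj u v)
  let F : Set V := {u | u ∈ FA ∨ u ∈ FB ∨ u ∈ FP ∨ u ∈ FQ ∨ u ∈ FE ∪ FD}
  have hFtarget : ∀ u ∈ F, ∃ v, Target u v := by
    rintro u (hu | hu | hu | hu | hu)
    · exact ⟨x, Or.inl ⟨hu, rfl⟩⟩
    · exact ⟨y, Or.inr (Or.inl ⟨hu, rfl⟩)⟩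
    · obtain ⟨a, ha, hua⟩ := hFP_star u hu
      exact ⟨a, Or.inr (Or.inr (Or.inl ⟨hu, ha, hua⟩))⟩
    · obtain ⟨a, ha, hua⟩ := hFQ_star u hu
      exact ⟨a, Or.inr (Or.inr (Or.inr (Or.inl ⟨hu, ha, hua⟩)))⟩
    · obtain ⟨c, hc, huc⟩ : ∃ c ∈ G.distCell x y 2 2, G.Adj u c :=
        hu.elim (fun hu => hDC u hu.1 hu.2.1) (fun hu => hDC u (hFD hu).1 (hFD hu).2.1)
      exact ⟨c, Or.inr (Or.inr (Or.inr (Or.inr ⟨hu, hc, huc⟩)))⟩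
  choose! π hπ using hFtarget
  -- The cells.
  have cFA {u : V} (hu : u ∈ FA) : G.dist x u = 1 ∧ G.dist y u = 2 := (hFA hu).1
  have cFB {u : V} (hu : u ∈ FB) : G.dist x u = 2 ∧ G.dist y u = 1 := (hFB hu).1.symm
  have cFP {u : V} (hu : u ∈ FP) : G.dist x u = 2 ∧ G.dist y u = 3 := (hFP hu).1
  have cFQ {u : V} (hu : u ∈ FQ) : G.dist x u = 3 ∧ G.dist y u = 2 := (hFQ hu).1.symm
  have cFE {u : V} (hu : u ∈ FE ∪ FD) : G.dist x u = 3 ∧ G.dist y u = 3 :=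
    hu.elim (fun hu => hu.1) (fun hu => (hFD hu).1)
  have F_A {u : V} (hu : u ∈ G.distCell x y 1 2) : u ∈ F → u ∈ FA := by
    obtain ⟨h1, h2⟩ := hu
    rintro (hu | hu | hu | hu | hu)
    · exact hu
    · have := cFB hu; omega
    · have := cFP hu; omega
    · have := cFQ hu; omega
    · have := cFE hu; omega
  have F_B {u : V} (hu : u ∈ G.distCell x y 2 1) : u ∈ F → u ∈ FB := by
    obtain ⟨h1, h2⟩ := hu
    rintro (hu | hu | hu | hu | hu)
    · have := cFA hu; omega
    · exact hu
    · have := cFP hu; omega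
    · have := cFQ hu; omega
    · have := cFE hu; omega
  have F_C {u : V} (hu : u ∈ G.distCell x y 2 2) : u ∉ F := by
    obtain ⟨h1, h2⟩ := hu
    rintro (hu | hu | hu | hu | hu)
    · have := cFA hu; omega
    · have := cFB hu; omega
    · have := cFP hu; omega
    · have := cFQ hu; omega
    · have := cFE hu; omega
  have F_P {u : V} (hu : u ∈ G.distCell x y 2 3) : u ∈ F → u ∈ FP := by
    obtain ⟨h1, h2⟩ := hu
    rintro (hu | hu | hu | hu | hu)
    · have := cFA hu; omega
    · have := cFB hu; omega
    · exact hu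
    · have := cFQ hu; omega
    · have := cFE hu; omega
  have F_Q {u : V} (hu : u ∈ G.distCell x y 3 2) : u ∈ F → u ∈ FQ := by
    obtain ⟨h1, h2⟩ := hu
    rintro (hu | hu | hu | hu | hu)
    · have := cFA hu; omega
    · have := cFB hu; omega
    · have := cFP hu; omega
    · exact hu
    · have := cFE hu; omega
  have F_D {u : V} (hu : u ∈ G.distCell x y 3 3) : u ∈ F → u ∈ FE ∪ FD := by
    obtain ⟨h1, h2⟩ := hu
    rintro (hu | hu | hu | hu | hu)
    · have := cFA hu; omega
    · have := cFB hu; omega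
    · have := cFP hu; omega
    · have := cFQ hu; omega
    · exact hu
  have tgtA {u : V} (hu : u ∈ FA) : π u = x := by
    have hc := cFA hu
    rcases hπ u (Or.inl hu) with h1 | h1 | h1 | h1 | h1
    · exact h1.2
    · have := cFB h1.1; omega
    · have := cFP h1.1; omega
    · have := cFQ h1.1; omega
    · have := cFE h1.1; omega
  have tgtB {u : V} (hu : u ∈ FB) : π u = y := by
    have hc := cFB hu
    rcases hπ u (Or.inr (Or.inl hu)) with h1 | h1 | h1 | h1 | h1
    · have := cFA h1.1; omega
    · exact h1.2
    · have := cFP h1.1; omega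
    · have := cFQ h1.1; omega
    · have := cFE h1.1; omega
  have tgtP {u : V} (hu : u ∈ FP) : π u ∈ reachNear G x y ∧ G.Adj u (π u) := by
    have hc := cFP hu
    rcases hπ u (Or.inr (Or.inr (Or.inl hu))) with h1 | h1 | h1 | h1 | h1
    · have := cFA h1.1; omega
    · have := cFB h1.1; omega
    · exact h1.2
    · have := cFQ h1.1; omega
    · have := cFE h1.1; omega
  have tgtQ {u : V} (hu : u ∈ FQ) : π u ∈ crossNear G y x ∧ G.Adj u (π u) := by
    have hc := cFQ hu
    rcases hπ u (Or.inr (Or.inr (Or.inr (Or.inl hu)))) with h1 | h1 | h1 | h1 | h1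
    · have := cFA h1.1; omega
    · have := cFB h1.1; omega
    · have := cFP h1.1; omega
    · exact h1.2
    · have := cFE h1.1; omega
  have tgtD {u : V} (hu : u ∈ FE ∪ FD) : π u ∈ G.distCell x y 2 2 ∧ G.Adj u (π u) := by
    have hc := cFE hu
    rcases hπ u (Or.inr (Or.inr (Or.inr (Or.inr hu)))) with h1 | h1 | h1 | h1 | h1
    · have := cFA h1.1; omega
    · have := cFB h1.1; omega
    · have := cFP h1.1; omega
    · have := cFQ h1.1; omega
    · exact h1.2
  -- The ranks.
  have rx : cellRank G x y x = 0 := by simp [cellRank]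
  have ry : cellRank G x y y = 1 := by simp [cellRank, dist_eq_one_iff_adj.2 h.adj]
  have rK {u : V} (hu : u ∈ innerNear G x y) : cellRank G x y u = 2 := by
    simp [cellRank, hu, hu.1.1, hu.1.2]
  have rA {u : V} (hu : u ∈ G.distCell x y 1 2) (hu' : u ∉ innerNear G x y) :
      cellRank G x y u = 3 := by simp [cellRank, hu', hu.1, hu.2]
  have rB {u : V} (hu : u ∈ G.distCell x y 2 1) : cellRank G x y u = 4 := by
    simp [cellRank, hu.1, hu.2]
  have rC {u : V} (hu : u ∈ G.distCell x y 2 2) : cellRank G x y u = 5 := by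
    simp [cellRank, hu.1, hu.2]
  have rP {u : V} (hu : u ∈ G.distCell x y 2 3) : cellRank G x y u = 6 := by
    simp [cellRank, hu.1, hu.2]
  have rQ {u : V} (hu : u ∈ G.distCell x y 3 2) : cellRank G x y u = 7 := by
    simp [cellRank, hu.1, hu.2]
  have rD {u : V} (hu : u ∈ G.distCell x y 3 3) : cellRank G x y u = 8 := by
    simp [cellRank, hu.1, hu.2]
  have nearA {a w : V} (ha : a ∈ G.distCell x y 1 2) (haw : G.Adj a w) (hw : w ≠ x)
      (hw' : w ∉ G.distCell x y 1 2) : a ∉ innerNear G x y :=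
    fun h1 => (h1.2 w haw).elim hw hw'
  -- Marks go down in rank, so the larger rank on a marked edge is that of the marking vertex.
  have hπr : ∀ u ∈ F, cellRank G x y (π u) < cellRank G x y u := by
    rintro u (hu | hu | hu | hu | hu)
    · rw [tgtA hu, rx, rK (hFA hu)]; omega
    · rw [tgtB hu, ry, rB (cFB hu)]; omega
    · obtain ⟨h1, h2⟩ := tgtP hu
      have hc := cFP hu
      rw [rA h1.1 (nearA h1.1 h2.symm (by rintro rfl; simp at hc)
        (fun h3 => by have := h3.1; omega)), rP hc]
      omega
    · obtain ⟨h1, h2⟩ := tgtQ hu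
      rw [rB h1.1.symm, rQ (cFQ hu)]; omega
    · rw [rC (tgtD hu).1, rD (cFE hu)]; omega
  -- The colours.
  let f := cellColor (cellRank G x y) F π
  have base {u v : V} (huv : cellRank G x y v ≤ cellRank G x y u) (hm : u ∈ F → π u ≠ v) :
      f s(u, v) = baseColor (cellRank G x y v) (cellRank G x y u) :=
    cellColor_base hπr huv hm
  have level {u v : V} (huv : cellRank G x y v = cellRank G x y u) :
      f s(u, v) = baseColor (cellRank G x y v) (cellRank G x y u) :=
    base huv.le fun hu h1 => by have := hπr u hu; rw [h1] at this; omega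
  have marked {u : V} (hu : u ∈ F) : f s(u, π u) = markedColor (cellRank G x y u) :=
    cellColor_marked hπr hu
  have adjx {u : V} {j : ℕ} (hu : u ∈ G.distCell x y 1 j) : G.Adj u x :=
    (dist_eq_one_iff_adj.1 hu.1).symm
  have adjy {u : V} {i : ℕ} (hu : u ∈ G.distCell x y i 1) : G.Adj u y :=
    (dist_eq_one_iff_adj.1 hu.2).symm
  have ne_x {u : V} {i j : ℕ} (hu : u ∈ G.distCell x y i j) (hi : i ≠ 0) : u ≠ x := by
    rintro rfl
    exact hi (hu.1.symm.trans dist_self)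
  have ne_y {u : V} {i j : ℕ} (hu : u ∈ G.distCell x y i j) (hj : j ≠ 0) : u ≠ y := by
    rintro rfl
    exact hj (hu.2.symm.trans dist_self)
  have cell_ne {u : V} {i j i' j' : ℕ} (hu : u ∈ G.distCell x y i j) (hij : i ≠ i' ∨ j ≠ j') :
      u ∉ G.distCell x y i' j' := by
    rintro ⟨h1, h2⟩
    obtain ⟨h3, h4⟩ := hu
    omega
  -- An edge from the outer part of a near cell.
  have outA {a w : V} {i j : ℕ} (ha : a ∈ G.distCell x y 1 2) (hw : w ∈ G.distCell x y i j)
      (haw : G.Adj a w) (hi : 1 < i) : a ∉ innerNear G x y :=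
    nearA ha haw (ne_x hw (by omega)) (cell_ne hw (by omega))
  have outB {b w : V} {i j : ℕ} (hw : w ∈ G.distCell x y i j)
      (hbw : G.Adj b w) (hj : 1 < j) : b ∉ FB := by
    intro hb
    rcases (hFB hb).2 w hbw with rfl | h1
    · exact ne_y hw (by omega) rfl
    · exact cell_ne hw (by omega) (mem_cell_symm.1 h1)
  have AX {a : V} (ha : a ∈ G.distCell x y 1 2) (ha' : a ∉ innerNear G x y) :
      G.RainbowLink f a x {1} := by
    refine .single (adjx ha) ((base (by rw [rx]; omega) ?_).trans (by rw [rx, rA ha ha']; rfl))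
    exact fun h1 => absurd (hFA (F_A ha h1)) ha'
  have BY {b : V} (hb : b ∈ G.distCell x y 2 1) (hb' : b ∉ FB) :
      G.RainbowLink f b y {2} := by
    refine .single (adjy hb) ((base (by rw [ry, rB hb]; omega) ?_).trans
      (by rw [ry, rB hb]; rfl))
    exact fun h1 => absurd (F_B hb h1) hb'
  have cAB {a b : V} (ha : a ∈ G.distCell x y 1 2) (hb : b ∈ G.distCell x y 2 1)
      (hab : G.Adj a b) : f s(b, a) = 8 := by
    have ha' := outA ha hb hab (by omega)
    refine (base (by rw [rA ha ha', rB hb]; omega) ?_).trans (by rw [rA ha ha', rB hb]; rfl)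
    intro h1 h2
    rw [tgtB (F_B hb h1)] at h2
    exact ne_y ha (by omega) h2.symm
  have cAC {a c : V} (ha : a ∈ G.distCell x y 1 2) (hc : c ∈ G.distCell x y 2 2)
      (hac : G.Adj a c) : f s(c, a) = 8 := by
    have ha' := outA ha hc hac (by omega)
    exact (base (by rw [rA ha ha', rC hc]; omega) (fun h1 => absurd h1 (F_C hc))).trans
      (by rw [rA ha ha', rC hc]; rfl)
  have cBC {b c : V} (hb : b ∈ G.distCell x y 2 1) (hc : c ∈ G.distCell x y 2 2) :
      f s(c, b) = 4 :=
    (base (by rw [rB hb, rC hc]; omega) (fun h1 => absurd h1 (F_C hc))).trans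
      (by rw [rB hb, rC hc]; rfl)
  have cAP {a u : V} (ha : a ∈ G.distCell x y 1 2) (hu : u ∈ G.distCell x y 2 3)
      (hau : G.Adj a u) (hm : u ∈ FP → π u ≠ a) : f s(u, a) = 3 := by
    have ha' := outA ha hu hau (by omega)
    exact (base (by rw [rA ha ha', rP hu]; omega) (fun h1 => hm (F_P hu h1))).trans
      (by rw [rA ha ha', rP hu]; rfl)
  have cBQ {b w : V} (hb : b ∈ G.distCell x y 2 1) (hw : w ∈ G.distCell x y 3 2)
      (hm : w ∈ FQ → π w ≠ b) : f s(w, b) = 4 :=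
    (base (by rw [rB hb, rQ hw]; omega) (fun h1 => hm (F_Q hw h1))).trans
      (by rw [rB hb, rQ hw]; rfl)
  have cCP {c u : V} (hc : c ∈ G.distCell x y 2 2) (hu : u ∈ G.distCell x y 2 3)
      (hm : u ∉ FP) : f s(u, c) = 8 :=
    (base (by rw [rC hc, rP hu]; omega) (fun h1 => absurd (F_P hu h1) hm)).trans
      (by rw [rC hc, rP hu]; rfl)
  have cCQ {c w : V} (hc : c ∈ G.distCell x y 2 2) (hw : w ∈ G.distCell x y 3 2)
      (hm : w ∉ FQ) : f s(w, c) = 6 :=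
    (base (by rw [rC hc, rQ hw]; omega) (fun h1 => absurd (F_Q hw h1) hm)).trans
      (by rw [rC hc, rQ hw]; rfl)
  have cCD {c d : V} (hc : c ∈ G.distCell x y 2 2) (hd : d ∈ G.distCell x y 3 3)
      (hm : d ∈ FE ∪ FD → π d ≠ c) : f s(d, c) = 5 :=
    (base (by rw [rC hc, rD hd]; omega) (fun h1 => hm (F_D hd h1))).trans
      (by rw [rC hc, rD hd]; rfl)
  have cPD {p d : V} (hp : p ∈ G.distCell x y 2 3) (hd : d ∈ G.distCell x y 3 3) :
      f s(d, p) = 5 := by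
    refine (base (by rw [rP hp, rD hd]; omega) fun h1 h2 => ?_).trans (by rw [rP hp, rD hd]; rfl)
    exact cell_ne hp (by omega) (h2 ▸ (tgtD (F_D hd h1)).1)
  have cQD {q d : V} (hq : q ∈ G.distCell x y 3 2) (hd : d ∈ G.distCell x y 3 3) :
      f s(d, q) = 6 := by
    refine (base (by rw [rQ hq, rD hd]; omega) fun h1 h2 => ?_).trans (by rw [rQ hq, rD hd]; rfl)
    exact cell_ne hq (by omega) (h2 ▸ (tgtD (F_D hd h1)).1)
  have cPQ {p q : V} (hp : p ∈ G.distCell x y 2 3) (hq : q ∈ G.distCell x y 3 2)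
      (hm : q ∉ FQ) : f s(q, p) = 8 :=
    (base (by rw [rP hp, rQ hq]; omega) (fun h1 => absurd (F_Q hq h1) hm)).trans
      (by rw [rP hp, rQ hq]; rfl)
  have cPP {u v : V} (hu : u ∈ G.distCell x y 2 3) (hv : v ∈ G.distCell x y 2 3) :
      f s(u, v) = 7 :=
    (level (by rw [rP hu, rP hv])).trans (by rw [rP hu, rP hv]; rfl)
  have cQQ {u v : V} (hu : u ∈ G.distCell x y 3 2) (hv : v ∈ G.distCell x y 3 2) :
      f s(u, v) = 7 :=
    (level (by rw [rQ hu, rQ hv])).trans (by rw [rQ hu, rQ hv]; rfl)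
  have cDD {u v : V} (hu : u ∈ G.distCell x y 3 3) (hv : v ∈ G.distCell x y 3 3) :
      f s(u, v) = 7 :=
    (level (by rw [rD hu, rD hv])).trans (by rw [rD hu, rD hv]; rfl)
  have cBB {u v : V} (hu : u ∈ G.distCell x y 2 1) (hv : v ∈ G.distCell x y 2 1) :
      f s(u, v) = 4 :=
    (level (by rw [rB hu, rB hv])).trans (by rw [rB hu, rB hv]; rfl)
  have cAA {u v : V} (hu : u ∈ G.distCell x y 1 2) (hv : v ∈ G.distCell x y 1 2)
      (hu' : u ∉ innerNear G x y) (hv' : v ∉ innerNear G x y) : f s(u, v) = 6 :=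
    (level (by rw [rA hu hu', rA hv hv'])).trans (by rw [rA hu hu', rA hv hv']; rfl)
  have cKA {k a : V} (hk : k ∈ innerNear G x y) (ha : a ∈ G.distCell x y 1 2) :
      f s(k, a) = 3 := by
    by_cases ha' : a ∈ innerNear G x y
    · exact (level (by rw [rK hk, rK ha'])).trans (by rw [rK hk, rK ha']; rfl)
    · rw [Sym2.eq_swap]
      exact (base (by rw [rK hk, rA ha ha']; omega) (fun h1 => absurd (hFA (F_A ha h1)) ha')).trans
        (by rw [rK hk, rA ha ha']; rfl)
  have mP {u : V} (hu : u ∈ FP) : f s(u, π u) = 5 :=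
    (marked (Or.inr (Or.inr (Or.inl hu)))).trans (by rw [rP (cFP hu)]; rfl)
  have mQ {u : V} (hu : u ∈ FQ) : f s(u, π u) = 6 :=
    (marked (Or.inr (Or.inr (Or.inr (Or.inl hu))))).trans (by rw [rQ (cFQ hu)]; rfl)
  have mD {u : V} (hu : u ∈ FE ∪ FD) : f s(u, π u) = 6 :=
    (marked (Or.inr (Or.inr (Or.inr (Or.inr hu))))).trans (by rw [rD (cFE hu)]; rfl)
  -- Routes from the middle cells.
  have CX {c : V} (hc : c ∈ G.distCell x y 2 2) : G.RainbowLink f c x {8, 1} := by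
    obtain ⟨a, hca, hax⟩ := h.connected.exists_adj_dist_eq (n := 1) hc.1
    have ha : a ∈ G.distCell x y 1 2 := by
      have h1 := h.step hca
      have h2 := h.cell_cases a
      have h3 := hc.2
      simp only [distCell, Set.mem_ofPred_eq] at h2 ⊢
      omega
    exact .cons hca (cAC ha hc hca.symm) (AX ha (outA ha hc hca.symm (by omega)))
      (by decide) (by decide)
  have CY {c : V} (hc : c ∈ G.distCell x y 2 2) : G.RainbowLink f c y {4, 2} := by
    obtain ⟨b, hcb, hby⟩ := h.connected.exists_adj_dist_eq (n := 1) hc.2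
    have hb : b ∈ G.distCell x y 2 1 := by
      have h1 := h.step hcb
      have h2 := h.cell_cases b
      have h3 := hc.1
      simp only [distCell, Set.mem_ofPred_eq] at h2 ⊢
      omega
    exact .cons hcb (cBC hb hc) (BY hb (outB hc hcb.symm (by omega))) (by decide) (by decide)
  have PA {u : V} (hu : u ∈ G.distCell x y 2 3) : ∃ a ∈ G.distCell x y 1 2, G.Adj u a := by
    obtain ⟨a, hua, hax⟩ := h.connected.exists_adj_dist_eq (n := 1) hu.1
    refine ⟨a, ⟨hax, ?_⟩, hua⟩
    have h1 := h.step hua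
    have h2 := h.cell_cases a
    have h3 := hu.2
    simp only [distCell, Set.mem_ofPred_eq] at h2
    omega
  have QB {w : V} (hw : w ∈ G.distCell x y 3 2) : ∃ b ∈ G.distCell x y 2 1, G.Adj w b := by
    obtain ⟨b, hwb, hby⟩ := h.connected.exists_adj_dist_eq (n := 1) hw.2
    refine ⟨b, ⟨?_, hby⟩, hwb⟩
    have h1 := h.step hwb
    have h2 := h.cell_cases b
    have h3 := hw.1
    simp only [distCell, Set.mem_ofPred_eq] at h2
    omega
  have PX_of {u a : V} (hu : u ∈ G.distCell x y 2 3) (ha : a ∈ G.distCell x y 1 2)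
      (hua : G.Adj u a) (hm : u ∈ FP → π u ≠ a) : G.RainbowLink f u x {3, 1} :=
    .cons hua (cAP ha hu hua.symm hm) (AX ha (outA ha hu hua.symm (by omega)))
      (by decide) (by decide)
  have QY_of {w b : V} (hw : w ∈ G.distCell x y 3 2) (hb : b ∈ G.distCell x y 2 1)
      (hwb : G.Adj w b) (hm : w ∈ FQ → π w ≠ b) : G.RainbowLink f w y {4, 2} :=
    .cons hwb (cBQ hb hw hm) (BY hb (outB hw hwb.symm (by omega))) (by decide) (by decide)
  have PX {u : V} (hu : u ∈ G.distCell x y 2 3) (hm : u ∉ FP) : G.RainbowLink f u x {3, 1} := by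
    obtain ⟨a, ha, hua⟩ := PA hu
    exact PX_of hu ha hua (fun h1 => absurd h1 hm)
  have QY {w : V} (hw : w ∈ G.distCell x y 3 2) (hm : w ∉ FQ) : G.RainbowLink f w y {4, 2} := by
    obtain ⟨b, hb, hwb⟩ := QB hw
    exact QY_of hw hb hwb (fun h1 => absurd h1 hm)
  have goodP {u w : V} {i j : ℕ} (hw : w ∈ G.distCell x y i j) (huw : G.Adj u w)
      (h1 : i ≠ 1 ∨ j ≠ 2) (h2 : i ≠ 2 ∨ j ≠ 3) : u ∉ innerFar G x y :=
    fun hu => (hu.2 w huw).elim (cell_ne hw h1) (cell_ne hw h2)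
  have goodQ {u w : V} {i j : ℕ} (hw : w ∈ G.distCell x y i j) (huw : G.Adj u w)
      (h1 : i ≠ 2 ∨ j ≠ 1) (h2 : i ≠ 3 ∨ j ≠ 2) : u ∉ innerFar G y x :=
    fun hu => (hu.2 w huw).elim (fun h3 => cell_ne hw h1 (mem_cell_symm.1 h3))
      (fun h3 => cell_ne hw h2 (mem_cell_symm.1 h3))
  -- Routes from the deep cell.
  have DX_of {d p : V} (hd : d ∈ G.distCell x y 3 3) (hdp : G.Adj d p)
      (hp : G.dist x p = 2) (hm : d ∈ FE ∪ FD → π d ≠ p) :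
      G.RainbowLink f d x {5, 3, 8, 1} := by
    have h1 : p ∈ G.distCell x y 2 2 ∨ p ∈ G.distCell x y 2 3 := by
      have h1 := h.step hdp
      have h2 := h.cell_cases p
      have h3 := hd.2
      simp only [distCell, Set.mem_ofPred_eq] at h2 ⊢
      omega
    rcases h1 with hp | hp
    · exact .cons hdp (cCD hp hd hm) (CX hp) (by decide) (by decide)
    · exact .cons hdp (cPD hp hd) (PX hp fun h2 => goodP hd hdp.symm (by omega) (by omega)
        (hFP h2)) (by decide) (by decide)
  have DX {d : V} (hd : d ∈ G.distCell x y 3 3) (hm : d ∉ FD) :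
      G.RainbowLink f d x {5, 3, 8, 1} := by
    by_cases hdE : d ∈ FE
    · obtain ⟨p, p', hp, hp', hpx, hpx', hne⟩ : ∃ p p', G.Adj d p ∧ G.Adj d p' ∧
          G.dist x p = 2 ∧ G.dist x p' = 2 ∧ p ≠ p' := by
        by_contra! hcon
        exact hdE.2.2 ⟨hd, hdE.2.1, hcon⟩
      by_cases hπp : π d = p
      · exact DX_of hd hp' hpx' fun _ h1 => hne (hπp.symm.trans h1)
      · exact DX_of hd hp hpx fun _ => hπp
    · obtain ⟨p, hp, hpx⟩ := h.connected.exists_adj_dist_eq (n := 2) hd.1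
      exact DX_of hd hp hpx fun h1 => (h1.elim hdE hm).elim
  have DY {d : V} (hd : d ∈ G.distCell x y 3 3) (hm : d ∈ FD ∨ d ∉ innerDeep G x y) :
      G.RainbowLink f d y {6, 4, 2} := by
    by_cases hdQ : ∃ w ∈ G.distCell x y 3 2, G.Adj d w
    · obtain ⟨w, hw, hdw⟩ := hdQ
      exact .cons hdw (cQD hw hd) (QY hw fun h2 => goodQ hd hdw.symm (by omega) (by omega)
        (hFQ h2)) (by decide) (by decide)
    · push Not at hdQ
      have hdF : d ∈ FE ∪ FD := hm.elim Or.inr fun h1 => Or.inl ⟨hd, hdQ, h1⟩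
      obtain ⟨h1, h2⟩ := tgtD hdF
      exact .cons h2 (mD hdF) (CY h1) (by decide) (by decide)
  -- Without a neighbour in (3,2), `d` has one in (2,2), which with `p` makes two at distance 2 from
  -- `x`.
  have D_of_P {d p : V} (hd : d ∈ G.distCell x y 3 3) (hp : p ∈ G.distCell x y 2 3)
      (hdp : G.Adj d p) : d ∉ innerDeep G x y := by
    intro hdI
    obtain ⟨c, hc, hdc⟩ := hDC d hd hdI.2.1
    have h1 := hdI.2.2 p c hdp hdc hp.1 hc.1
    exact cell_ne hp (by omega) (h1 ▸ hc)
  -- Second routes from the far cells.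
  have PY_good {u : V} (hu : u ∈ G.distCell x y 2 3) (hu' : u ∉ innerFar G x y) :
      G.RainbowLink f u y {8, 5, 6, 4, 2} := by
    have huF : u ∉ FP := fun h1 => hu' (hFP h1)
    obtain ⟨w, huw, hw⟩ : ∃ w, G.Adj u w ∧ (w ∈ G.distCell x y 2 2 ∨ w ∈ G.distCell x y 3 2 ∨
        w ∈ G.distCell x y 3 3) := by
      by_contra! hcon
      refine hu' ⟨hu, fun w huw => ?_⟩
      obtain ⟨h1, h2, h3⟩ := hcon w huw
      have h4 := h.step huw
      have h5 := h.cell_cases w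
      obtain ⟨h6, h7⟩ := hu
      simp only [distCell, Set.mem_ofPred_eq] at h1 h2 h3 h5 ⊢
      omega
    rcases hw with hw | hw | hw
    · exact .cons huw (cCP hw hu huF) (CY hw) (by decide) (by decide)
    · have hwF : w ∉ FQ := fun h1 => goodQ hu huw.symm (by omega) (by omega) (hFQ h1)
      exact .cons huw (Sym2.eq_swap ▸ cPQ hu hw hwF) (QY hw hwF) (by decide) (by decide)
    · exact .cons huw (Sym2.eq_swap ▸ cPD hu hw) (DY hw (Or.inr (D_of_P hw hu huw.symm)))
        (by decide) (by decide)
  have QX_good {u : V} (hu : u ∈ G.distCell x y 3 2) (hu' : u ∉ innerFar G y x) :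
      G.RainbowLink f u x {1, 3, 5, 6, 8} := by
    have huF : u ∉ FQ := fun h1 => hu' (hFQ h1)
    obtain ⟨w, huw, hw⟩ : ∃ w, G.Adj u w ∧ (w ∈ G.distCell x y 2 2 ∨ w ∈ G.distCell x y 2 3 ∨
        w ∈ G.distCell x y 3 3) := by
      by_contra! hcon
      refine hu' ⟨mem_cell_symm.2 hu, fun w huw => ?_⟩
      obtain ⟨h1, h2, h3⟩ := hcon w huw
      have h4 := h.step huw
      have h5 := h.cell_cases w
      obtain ⟨h6, h7⟩ := hu
      simp only [distCell, Set.mem_ofPred_eq] at h1 h2 h3 h5 ⊢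
      omega
    rcases hw with hw | hw | hw
    · exact .cons huw (cCQ hw hu huF) (CX hw) (by decide) (by decide)
    · have hwF : w ∉ FP := fun h1 => goodP hu huw.symm (by omega) (by omega) (hFP h1)
      exact .cons huw (cPQ hw hu huF) (PX hw hwF) (by decide) (by decide)
    · have hwF : w ∉ FD := fun h1 => (hFD h1).2.1 u hu huw.symm
      exact .cons huw (Sym2.eq_swap ▸ cQD hu hw) (DX hw hwF) (by decide) (by decide)
  have crossY {a : V} (ha : a ∈ crossNear G x y) : G.RainbowLink f a y {8, 2} := by
    obtain ⟨ha, b, hb, hab⟩ := ha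
    exact .cons hab (Sym2.eq_swap ▸ cAB ha hb hab) (BY hb (outB ha hab.symm (by omega)))
      (by decide) (by decide)
  have crossX {b : V} (hb : b ∈ crossNear G y x) : G.RainbowLink f b x {8, 1} := by
    obtain ⟨hb, a, ha, hba⟩ := hb
    replace hb := mem_cell_symm.1 hb
    replace ha := mem_cell_symm.1 ha
    exact .cons hba (cAB ha hb hba.symm) (AX ha (outA ha hb hba.symm (by omega)))
      (by decide) (by decide)
  have reachY {a : V} (ha : a ∈ reachNear G x y) (haI : a ∉ innerNear G x y) :
      G.RainbowLink f a y {8, 4, 6, 2} := by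
    obtain ⟨ha, h1 | ⟨c, hc, hac⟩ | ⟨a', ha', haa'⟩⟩ := ha
    · exact (crossY h1).mono (by decide)
    · exact .cons hac (Sym2.eq_swap ▸ cAC ha hc hac) (CY hc) (by decide) (by decide)
    · obtain ⟨b, hb, hab⟩ := ha'.2
      exact .cons haa' (cAA ha ha'.1 haI (outA ha'.1 hb hab (by omega)))
        (crossY ha') (by decide) (by decide)
  have PF {u : V} (hu : u ∈ FP) : G.RainbowLink f u x {5, 1} ∧
      G.RainbowLink f u y {2, 4, 5, 6, 8} := by
    obtain ⟨h1, h2⟩ := tgtP hu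
    have h3 := outA h1.1 (cFP hu) h2.symm (by omega)
    exact ⟨.cons h2 (mP hu) (AX h1.1 h3) (by decide) (by decide),
      .cons h2 (mP hu) (reachY h1 h3) (by decide) (by decide)⟩
  -- Here `crossNear` is essential: the route to `x` must avoid colour 4 to be disjoint from the
  -- routes `{4, 2}` of unmarked vertices in the cell, and edges inside (2,1) or from (2,1) to (2,2)
  -- have colour 4. On the other side `reachNear` suffices, because its detours avoid 1 and 3.
  have QF {u : V} (hu : u ∈ FQ) : G.RainbowLink f u y {6, 2} ∧
      G.RainbowLink f u x {6, 8, 1} := by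
    obtain ⟨h1, h2⟩ := tgtQ hu
    exact ⟨.cons h2 (mQ hu) (BY (mem_cell_symm.1 h1.1) (outB (cFQ hu) h2.symm (by omega)))
      (by decide) (by decide), .cons h2 (mQ hu) (crossX h1) (by decide) (by decide)⟩
  have PF' {u : V} (hu : u ∈ FP) : G.RainbowLink f u x {7, 3, 1} := by
    rcases hFP_nbr u hu (π u) with ⟨a, ha, hne, hua⟩ | ⟨r, hr, hrF, hur⟩
    · exact (PX_of (cFP hu) ha hua fun _ => hne.symm).mono (by decide)
    · exact .cons hur (cPP (cFP hu) hr) (PX hr hrF) (by decide) (by decide)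
  have QF' {u : V} (hu : u ∈ FQ) : G.RainbowLink f u y {7, 4, 2} := by
    rcases hFQ_nbr u hu (π u) with ⟨a, ha, hne, hua⟩ | ⟨r, hr, hrF, hur⟩
    · exact (QY_of (cFQ hu) (mem_cell_symm.1 ha) hua fun _ => hne.symm).mono (by decide)
    · have hr' := mem_cell_symm.1 hr
      exact .cons hur (cQQ (cFQ hu) hr') (QY hr' hrF) (by decide) (by decide)
  have PY {u : V} (hu : u ∈ G.distCell x y 2 3) (hm : u ∉ FP) :
      G.RainbowLink f u y {2, 4, 5, 6, 7, 8} := by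
    by_cases huI : u ∈ innerFar G x y
    · obtain ⟨w, hw, huw, h1 | h1⟩ := hFP_dom u huI hm
      · exact .cons huw (cPP hu hw) (PY_good hw h1) (by decide) (by decide)
      · exact .cons huw (cPP hu hw) (PF h1).2 (by decide) (by decide)
    · exact (PY_good hu huI).mono (by decide)
  have QX {u : V} (hu : u ∈ G.distCell x y 3 2) (hm : u ∉ FQ) :
      G.RainbowLink f u x {1, 3, 5, 6, 7, 8} := by
    by_cases huI : u ∈ innerFar G y x
    · obtain ⟨w, hw, huw, h1 | h1⟩ := hFQ_dom u huI hm
      · have hw' := mem_cell_symm.1 hw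
        exact .cons huw (cQQ hu hw') (QX_good hw' h1) (by decide) (by decide)
      · exact .cons huw (cQQ hu (mem_cell_symm.1 hw)) (QF h1).2 (by decide) (by decide)
    · exact (QX_good hu huI).mono (by decide)
  refine rainbowConnectionNumber_le_of_rainbowLink (f := f) (exists_rainbowLink_of_profiles h.adj
    ?_ fun v => ?_)
  · rw [Sym2.eq_swap]
    refine (base (by rw [rx, ry]; omega) ?_).trans (by rw [rx, ry]; rfl)
    rintro (hu | hu | hu | hu | hu)
    · have := (cFA hu).2; simp at this
    · have := (cFB hu).2; simp at this
    · have := (cFP hu).2; simp at this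
    · have := (cFQ hu).2; simp at this
    · have := (cFE hu).2; simp at this
  rcases h.cell_cases v with hv | hv | hv | hv | hv | hv | hv | hv
  · rw [h.eq_left hv]
    exact ⟨[(false, ∅)], by decide, by simpa using .refl _ _⟩
  · rw [h.symm.eq_left (mem_cell_symm.2 hv)]
    exact ⟨[(true, ∅)], by decide, by simpa using .refl _ _⟩
  · by_cases hvI : v ∈ innerNear G x y
    · have hKX {k : V} (hk : k ∈ innerNear G x y) (hkF : k ∉ FA) : f s(k, x) = 1 :=
        (base (by rw [rx]; omega) (fun h1 => absurd (F_A hk.1 h1) hkF)).trans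
          (by rw [rx, rK hk]; rfl)
      have hKF {k : V} (hk : k ∈ FA) : f s(k, x) = 5 := by
        have h1 := marked (Or.inl hk)
        rw [tgtA hk] at h1
        exact h1.trans (by rw [rK (hFA hk)]; rfl)
      by_cases hvF : v ∈ FA
      · refine ⟨[(false, {5}), (false, {3, 1})], by decide, ?_⟩
        obtain ⟨r, hr, hrF, hvr⟩ := hFA_nbr v hvF
        have hrx : G.RainbowLink f r x {1} := by
          by_cases hrI : r ∈ innerNear G x y
          · exact .single (adjx hr) (hKX hrI hrF)
          · exact AX hr hrI
        simpa using ⟨.single (adjx hv) (hKF hvF),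
          .cons hvr (cKA hvI hr) hrx (by decide) (by decide)⟩
      · refine ⟨[(false, {1}), (false, {3, 5})], by decide, ?_⟩
        obtain ⟨r, hr, hvr⟩ := hFA_dom v hvI hvF
        simpa using ⟨.single (adjx hv) (hKX hvI hvF), .cons hvr (cKA hvI (cFA hr))
          (.single (adjx (cFA hr)) (hKF hr)) (by decide) (by decide)⟩
    · refine ⟨[(false, {1}), (true, {2, 3, 4, 5, 6, 7, 8})], by decide, ?_⟩
      obtain ⟨w, hvw, hwx, hwA⟩ : ∃ w, G.Adj v w ∧ w ≠ x ∧ w ∉ G.distCell x y 1 2 := by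
        by_contra! hcon
        exact hvI ⟨hv, fun w hw => or_iff_not_imp_left.2 (hcon w hw)⟩
      have hw : w ∈ G.distCell x y 2 1 ∨ w ∈ G.distCell x y 2 2 ∨ w ∈ G.distCell x y 2 3 := by
        have h1 := h.step hvw
        have h2 := h.cell_cases w
        have h3 := h.dist_pos.2 hwx
        obtain ⟨h4, h5⟩ := hv
        simp only [distCell, Set.mem_ofPred_eq] at hwA h2 ⊢
        omega
      have hY : G.RainbowLink f v y {2, 3, 4, 5, 6, 7, 8} := by
        rcases hw with hw | hw | hw
        · exact (crossY ⟨hv, w, hw, hvw⟩).mono (by decide)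
        · exact .cons hvw (Sym2.eq_swap ▸ cAC hv hw hvw) (CY hw) (by decide) (by decide)
        · by_cases hwF : w ∈ FP
          -- If `w` marks its edge to `v`, then `v` itself is in `reachNear` and need not pass
          -- through `w`.
          · by_cases hπw : π w = v
            · exact (reachY (hπw ▸ (tgtP hwF).1) hvI).mono (by decide)
            · exact .cons hvw (Sym2.eq_swap ▸ cAP hv hw hvw (fun _ => hπw)) (PF hwF).2
                (by decide) (by decide)
          · exact .cons hvw (Sym2.eq_swap ▸ cAP hv hw hvw (fun h1 => absurd h1 hwF))
              (PY hw hwF) (by decide) (by decide)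
      simpa using ⟨AX hv hvI, hY⟩
  · by_cases hvI : v ∈ innerNear G y x
    · have hKF {k : V} (hk : k ∈ FB) : f s(k, y) = 6 := by
        have h1 := marked (Or.inr (Or.inl hk))
        rw [tgtB hk] at h1
        exact h1.trans (by rw [rB (cFB hk)]; rfl)
      by_cases hvF : v ∈ FB
      · refine ⟨[(true, {6}), (true, {4, 2})], by decide, ?_⟩
        obtain ⟨r, hr, hrF, hvr⟩ := hFB_nbr v hvF
        replace hr := mem_cell_symm.1 hr
        simpa using ⟨.single (adjy hv) (hKF hvF),
          .cons hvr (cBB hv hr) (BY hr hrF) (by decide) (by decide)⟩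
      · refine ⟨[(true, {2}), (true, {4, 6})], by decide, ?_⟩
        obtain ⟨r, hr, hvr⟩ := hFB_dom v hvI hvF
        simpa using ⟨BY hv hvF, .cons hvr (cBB hv (cFB hr))
          (.single (adjy (cFB hr)) (hKF hr)) (by decide) (by decide)⟩
    · refine ⟨[(true, {2}), (false, {1, 3, 4, 5, 6, 7, 8})], by decide, ?_⟩
      obtain ⟨w, hvw, hwy, hwB⟩ : ∃ w, G.Adj v w ∧ w ≠ y ∧ w ∉ G.distCell x y 2 1 := by
        by_contra! hcon
        exact hvI ⟨mem_cell_symm.2 hv, fun w hw => or_iff_not_imp_left.2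
          fun h1 => mem_cell_symm.2 (hcon w hw h1)⟩
      have hw : w ∈ G.distCell x y 1 2 ∨ w ∈ G.distCell x y 2 2 ∨ w ∈ G.distCell x y 3 2 := by
        have h1 := h.step hvw
        have h2 := h.cell_cases w
        have h3 := h.symm.dist_pos.2 hwy
        obtain ⟨h4, h5⟩ := hv
        simp only [distCell, Set.mem_ofPred_eq] at hwB h2 ⊢
        omega
      have hX : G.RainbowLink f v x {1, 3, 4, 5, 6, 7, 8} := by
        rcases hw with hw | hw | hw
        · exact (crossX ⟨mem_cell_symm.2 hv, w, mem_cell_symm.2 hw, hvw⟩).mono (by decide)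
        · exact .cons hvw (Sym2.eq_swap ▸ cBC hv hw) (CX hw) (by decide) (by decide)
        · by_cases hwF : w ∈ FQ
          · by_cases hπw : π w = v
            · exact (crossX (hπw ▸ (tgtQ hwF).1)).mono (by decide)
            · exact .cons hvw (Sym2.eq_swap ▸ cBQ hv hw (fun _ => hπw)) (QF hwF).2
                (by decide) (by decide)
          · exact .cons hvw (Sym2.eq_swap ▸ cBQ hv hw (fun h1 => absurd h1 hwF))
              (QX hw hwF) (by decide) (by decide)
      simpa using ⟨BY hv fun h1 => hvI (hFB h1), hX⟩
  · exact ⟨[(false, {8, 1}), (true, {4, 2})], by decide, by simpa using ⟨CX hv, CY hv⟩⟩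
  · by_cases hvF : v ∈ FP
    · exact ⟨[(false, {5, 1}), (false, {7, 3, 1}), (true, {2, 4, 5, 6, 8})], by decide,
        by simpa using ⟨(PF hvF).1, PF' hvF, (PF hvF).2⟩⟩
    · exact ⟨[(false, {3, 1}), (true, {2, 4, 5, 6, 7, 8})], by decide,
        by simpa using ⟨PX hv hvF, PY hv hvF⟩⟩
  · by_cases hvF : v ∈ FQ
    · exact ⟨[(true, {6, 2}), (true, {7, 4, 2}), (false, {6, 8, 1})], by decide,
        by simpa using ⟨(QF hvF).1, QF' hvF, (QF hvF).2⟩⟩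
    · exact ⟨[(true, {4, 2}), (false, {1, 3, 5, 6, 7, 8})], by decide,
        by simpa using ⟨QY hv hvF, QX hv hvF⟩⟩
  · by_cases hvF : v ∈ FD
    · refine ⟨[(false, {7, 5, 3, 8, 1}), (true, {6, 4, 2})], by decide, ?_⟩
      obtain ⟨r, hr, hrF, hvr⟩ := hFD_nbr v hvF
      simpa using ⟨.cons hvr (cDD hv hr.1) (DX hr.1 hrF) (by decide) (by decide),
        DY hv (Or.inl hvF)⟩
    · refine ⟨[(false, {5, 3, 8, 1}), (true, {7, 6, 4, 2})], by decide, ?_⟩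
      have hY : G.RainbowLink f v y {7, 6, 4, 2} := by
        by_cases hvI : v ∈ innerDeep G x y
        · obtain ⟨w, hw, hvw, h1⟩ := hFD_dom v hvI hvF
          exact .cons hvw (cDD hv hw) (DY hw h1.symm) (by decide) (by decide)
        · exact (DY hv (Or.inr hvI)).mono (by decide)
      simpa using ⟨DX hv hvF, hY⟩

theorem rainbowConnectionNumber_le_nine [Finite V] (h : G.IsTriangleFreeEdge x y) :
    G.rainbowConnectionNumber ≤ 9 :=
  h.crossDominates_or.elim h.symm.rainbowConnectionNumber_le_nine_of_crossDominates
    h.rainbowConnectionNumber_le_nine_of_crossDominates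

end IsTriangleFreeEdge
end EdgeRoot
end SimpleGraph

/-! ### The case split -/

theorem theorem3 {V : Type*} [Finite V] (G : SimpleGraph V)
    (hbridgeless : G.Bridgeless) (hdiam : G.diam = 3) :
    G.rainbowConnectionNumber ≤ 9 := by
  -- `diam` takes the value 0 when the extended diameter is infinite, so a nonzero value yields
  -- connectedness.
  have hne : G.diam ≠ 0 := by omega
  have : Nontrivial V := SimpleGraph.nontrivial_of_diam_ne_zero hne
  have htop := SimpleGraph.ediam_ne_top_of_diam_ne_zero hne
  have hG : G.Connected := SimpleGraph.connected_of_ediam_ne_top htop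
  have hdist (u v : V) : G.dist u v ≤ 3 := hdiam ▸ SimpleGraph.dist_le_diam htop
  by_cases htri : ∀ u v, G.Adj u v → ∃ w, G.Adj u w ∧ G.Adj v w
  · exact SimpleGraph.rainbowConnectionNumber_le_nine_of_triangles hG hdist htri
  · push Not at htri
    obtain ⟨x, y, hxy, hw⟩ := htri
    exact SimpleGraph.IsTriangleFreeEdge.rainbowConnectionNumber_le_nine (x := x) (y := y)
      ⟨hG, hdist, hbridgeless.exists_adj_ne, hxy, hw _⟩
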